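/- Let $n\ge 1$ and let $\alpha_1,\dots,\alpha_n\in\mathbb{Z}_{\ge 0}^n$ be multiindices which are linearly independent as vectors in $\mathbb{R}^n$ and satisfy $\alpha_1+\cdots+\alpha_n=(\sigma,\dots,\sigma)$ for some integer $\sigma$ (necessarily positive). Write $t^{\alpha}=\prod_{j=1}^n t_j^{\alpha^{(j)}}$ for $t\in\mathbb{R}^n$ and $\alpha=(\alpha^{(1)},\dots,\alpha^{(n)})$, and for functions $f$ on $\mathbb{R}^n\times\mathbb{R}$ define \[ Rf(y_0,\dots,y_n) := \int_{\mathbb{R}^n} f\bigl(t,\; y_0+y_1t^{\alpha_1}+\cdots+y_nt^{\alpha_n}\bigr)\,dt,\qquad (y_0,\dots,y_n)\in\mathbb{R}^{n+1}. \] Then $R$ is bounded from $L^{\frac{n+1+\sigma}{n+1}}(\mathbb{R}^n\times\mathbb{R})$ to $L^{n+1+\sigma}(\mathbb{R}^{n+1})$: there is a constant $C<\infty$ (depending only on $n,\alpha_1,\dots,\alpha_n$) such that for every $f\in L^{\frac{n+1+\sigma}{n+1}}(\mathbb{R}^n\times\mathbb{R})$ (real- or complex-valued) the integral defining $Rf(y)$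 converges absolutely for almost every $y\in\mathbb{R}^{n+1}$, and \[ \|Rf\|_{L^{n+1+\sigma}(\mathbb{R}^{n+1})}\le C\,\|f\|_{L^{\frac{n+1+\sigma}{n+1}}(\mathbb{R}^n\times\mathbb{R})}. \] -/

import Mathlib

open MeasureTheory
open scoped NNReal ENNReal

/-- The monomial `t ^ α = ∏ j, t_j ^ α_j` for a multiindex `α` of length `n`. -/
def multiPow {n : ℕ} (t : Fin n → ℝ) (α : Fin n → ℕ) : ℝ :=
  ∏ j, t j ^ α j

/-- The point `(t, y_0 + y_1 t ^ α_1 + ⋯ + y_n t ^ α_n)` of `ℝⁿ × ℝ`. The multiindices are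
numbered from `0`, so the coefficient of `t ^ (α i)` is `y i.succ`. -/
def graphPoint {n : ℕ} (α : Fin n → Fin n → ℕ) (y : Fin (n + 1) → ℝ) (t : Fin n → ℝ) :
    (Fin n → ℝ) × ℝ :=
  (t, y 0 + ∑ i, y i.succ * multiPow t (α i))

/-- The averaging operator
`R f (y_0, …, y_n) = ∫ f (t, y_0 + y_1 t ^ α_1 + ⋯ + y_n t ^ α_n) dt`. -/
noncomputable def averagingOp {𝕜 : Type*} [RCLike 𝕜] {n : ℕ} (α : Fin n → Fin n → ℕ)
    (f : (Fin n → ℝ) × ℝ → 𝕜) (y : Fin (n + 1) → ℝ) : 𝕜 :=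
  ∫ t : Fin n → ℝ, f (graphPoint α y t)

/-! Write v(t) = (1, t^{α_1}, …, t^{α_n}) and p = (n+1+σ)/(n+1). The core is a geometric inequality
for densities G ≥ 0 on ℝⁿ (`exists_lintegral_pow_le_lintegral_det`): (∫ G)^{n+1+σ} ≤ K ∫ ∏ G(τ_i)^p
|det(v(τ_0), …, v(τ_n))| dτ. Given it, take G(t) = |f|(t, y · v(t)) and integrate in y. For fixed τ
the map y ↦ (y · v(τ_i))_i is linear with exactly this determinant, so the determinant cancels
against the Jacobian and Tonelli leaves K (∫ |f|^p)^{n+1}.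

For the geometric inequality, let D_k be the infimum over c of ∫ G^p |v_k + ∑_{j<k} c_j v_j|. A
Gram–Schmidt argument in L¹ bounds ∏ D_k by the determinant integral (`prod_le_lintegral_det`).
Near-optimal c and the weights L_k ≈ 1/D_k give a size function B = ∑ L_k |v_k + ∑_{j<k} c_{kj} v_j|
with ∫ G^p B ≤ n+1. Hölder's inequality then reduces everything to (∫ B^{-(n+1)/σ})^σ ≤ K ∏ 1/L_k.

That bound is where the monomials enter. Since α_1 + ⋯ + α_n = (σ, …, σ), the Jacobian of u =
(t^{α_i}) is a constant times ∏ |u_i|^{1-1/σ}, a function of u alone. In the u variables B is a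
triangular affine expression, and integrating one coordinate at a time gives the bound uniformly in
c. -/

/-! ### Product measures and average determinants -/

section ProductMeasure

variable {X : Type*} [MeasureSpace X] [SigmaFinite (volume : Measure X)]

lemma measurable_finSnoc {Y : Type*} [MeasurableSpace Y] (n : ℕ) :
    Measurable (fun p : (Fin n → Y) × Y => (Fin.snoc p.1 p.2 : Fin (n + 1) → Y)) := by
  refine measurable_pi_lambda _ fun i => ?_
  refine Fin.lastCases ?_ (fun j => ?_) i
  · simpa using measurable_snd
  · simpa [Function.comp_def] using (measurable_pi_apply j).comp measurable_fst

lemma lintegral_finSnoc {n : ℕ} {H : (Fin (n + 1) → X) → ℝ≥0∞} (hH : Measurable H) :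
    ∫⁻ τ, H τ = ∫⁻ τ : Fin n → X, ∫⁻ x, H (Fin.snoc τ x : Fin (n + 1) → X) := by
  have h := (volume_preserving_piFinSuccAbove (fun _ : Fin (n + 1) => X) (Fin.last n)).symm
  rw [← h.lintegral_comp_emb (MeasurableEquiv.measurableEmbedding _)]
  rw [Measure.volume_eq_prod, lintegral_prod_symm]
  · simp [MeasurableEquiv.piFinSuccAbove_symm_apply, Fin.insertNthEquiv, Fin.insertNth_last']
  · exact (hH.comp (MeasurableEquiv.measurable _)).aemeasurable

lemma lintegral_finProd {n : ℕ} {g : Fin n → X → ℝ≥0∞} (hg : ∀ i, Measurable (g i)) :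
    ∫⁻ τ : Fin n → X, ∏ i, g i (τ i) = ∏ i, ∫⁻ x, g i x := by
  induction n with
  | zero => simp [volume_pi]
  | succ n ih =>
    have hmeas : Measurable fun τ : Fin n → X => ∏ i : Fin n, g i.castSucc (τ i) :=
      Finset.measurable_prod _ fun i _ => (hg i.castSucc).comp (measurable_pi_apply i)
    have hmeas' : Measurable fun τ : Fin (n + 1) → X => ∏ i, g i (τ i) :=
      Finset.measurable_prod _ fun i _ => (hg i).comp (measurable_pi_apply i)
    rw [lintegral_finSnoc hmeas']
    simp only [Fin.prod_univ_castSucc, Fin.snoc_castSucc, Fin.snoc_last]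
    simp_rw [lintegral_const_mul _ (hg (Fin.last n))]
    rw [lintegral_mul_const _ hmeas, ih fun i => hg i.castSucc]

/-- The integral of the absolute determinant of `d` independent samples of a random vector is at
least the product of its `L¹` distances to the spans of the preceding coordinates. -/
lemma prod_le_lintegral_det (v : ℕ → X → ℝ) (hv : ∀ k, Measurable (v k)) (W : X → ℝ≥0∞)
    (hW : Measurable W) (D : ℕ → ℝ≥0∞)
    (hD : ∀ k, ∀ c : ℕ → ℝ, D k ≤ ∫⁻ x, W x * ‖v k x + ∑ j ∈ Finset.range k, c j * v j x‖ₑ)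
    (d : ℕ) :
    ∏ k ∈ Finset.range d, D k ≤
      ∫⁻ τ : Fin d → X, (∏ i, W (τ i)) *
        ‖(Matrix.of fun i j : Fin d => v j (τ i)).det‖ₑ := by
  have hdet : ∀ d : ℕ, Measurable fun τ : Fin d → X =>
      (Matrix.of fun i j : Fin d => v j (τ i)).det := by
    intro d
    simp only [Matrix.det_apply, Matrix.of_apply]
    refine Finset.measurable_sum _ fun σ _ => Measurable.const_smul ?_ _
    exact Finset.measurable_prod _ fun i _ => (hv _).comp (measurable_pi_apply _)
  have hprod : ∀ d : ℕ, Measurable fun τ : Fin d → X => ∏ i, W (τ i) := fun d =>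
    Finset.measurable_prod _ fun i _ => hW.comp (measurable_pi_apply _)
  have hmeas : ∀ d : ℕ, Measurable fun τ : Fin d → X =>
      (∏ i, W (τ i)) * ‖(Matrix.of fun i j : Fin d => v j (τ i)).det‖ₑ := fun d =>
    (hprod d).mul (hdet d).enorm
  induction d with
  | zero => simp [volume_pi]
  | succ d ih =>
    rw [Finset.prod_range_succ, lintegral_finSnoc (hmeas _)]
    refine (mul_le_mul_left ih _).trans ?_
    rw [← lintegral_mul_const _ (hmeas _)]
    refine lintegral_mono fun τ => ?_
    simp only [Fin.prod_univ_castSucc, Fin.snoc_castSucc, Fin.snoc_last, mul_assoc]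
    -- Cofactors along the last row: they depend only on the first `d` samples, and the last of them
    -- is their determinant `δ`.
    set κ : Fin (d + 1) → ℝ := fun j => (-1) ^ (d + (j : ℕ)) *
      ((Matrix.of fun (i : Fin d) (l : Fin (d + 1)) => v l (τ i)).submatrix id j.succAbove).det
      with hκ
    set δ := (Matrix.of fun i j : Fin d => v j (τ i)).det with hδ
    have hlast : κ (Fin.last d) = δ := by
      have : (-1 : ℝ) ^ (d + d) = 1 := Even.neg_one_pow ⟨d, rfl⟩
      simp only [hκ, Fin.val_last, this, one_mul, hδ]
      congr 1
      ext i j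
      simp
    have hexp : ∀ x, (Matrix.of fun i j : Fin (d + 1) =>
        v j ((Fin.snoc τ x : Fin (d + 1) → X) i)).det = ∑ j, κ j * v j x := by
      intro x
      rw [Matrix.det_succ_row _ (Fin.last d)]
      refine Finset.sum_congr rfl fun j _ => ?_
      simp only [hκ, Fin.val_last, Matrix.of_apply, Fin.snoc_last]
      rw [mul_right_comm]
      congr 3
      ext i l
      simp
    rw [lintegral_const_mul]
    swap
    · exact hW.mul (((hdet _).comp ((measurable_finSnoc d).comp
        (measurable_const.prodMk measurable_id))).enorm)
    gcongr
    by_cases h0 : δ = 0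
    · simp [h0]
    -- Dividing the expansion by `δ` makes the coefficient of `v d` equal to 1, so that `hD` applies
    -- to the remaining ones.
    obtain ⟨c, hc⟩ : ∃ c : ℕ → ℝ, ∀ j : Fin d, c j = κ j.castSucc / δ :=
      ⟨fun k => if h : k < d then κ (Fin.castSucc ⟨k, h⟩) / δ else 0, fun j => by simp⟩
    have hfac : ∀ x, ∑ j, κ j * v j x = δ * (v d x + ∑ j ∈ Finset.range d, c j * v j x) := by
      intro x
      rw [Fin.sum_univ_castSucc, hlast, mul_add, Finset.mul_sum, add_comm, Finset.sum_range]
      simp only [Fin.val_castSucc, Fin.val_last, hc]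
      congr 1
      refine Finset.sum_congr rfl fun j _ => ?_
      field_simp
    simp only [hexp, hfac, enorm_mul]
    calc ‖δ‖ₑ * D d ≤ ‖δ‖ₑ * ∫⁻ x, W x * ‖v d x + ∑ j ∈ Finset.range d, c j * v j x‖ₑ := by
          gcongr; exact hD d c
      _ = _ := by
          rw [← lintegral_const_mul' _ _ enorm_ne_top]
          simp only [mul_left_comm]

end ProductMeasure

/-! ### Power weights and triangular affine sizes -/

lemma lintegral_eq_two_mul_Ioi_of_even {f : ℝ → ℝ≥0∞} (hf : ∀ x, f (-x) = f x) :
    ∫⁻ x, f x = 2 * ∫⁻ x in Set.Ioi 0, f x := by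
  have h1 : ∫⁻ x in Set.Iio (0 : ℝ), f x = ∫⁻ x in Set.Ioi (0 : ℝ), f x := by
    have := (Measure.measurePreserving_neg (volume : Measure ℝ)).setLIntegral_comp_preimage_emb
      (MeasurableEquiv.neg ℝ).measurableEmbedding f (Set.Iio 0)
    rw [← this]
    simp [hf]
  rw [← lintegral_add_compl f (measurableSet_Ioi (a := (0 : ℝ))), Set.compl_Ioi,
    setLIntegral_congr Iio_ae_eq_Iic.symm, h1, two_mul]

lemma enorm_rpow_eq_ofReal {x : ℝ} (hx : 0 < x) (r : ℝ) :
    ‖x‖ₑ ^ r = ENNReal.ofReal (x ^ r) := by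
  rw [Real.enorm_eq_ofReal hx.le, ENNReal.ofReal_rpow_of_pos hx]

/-- `a < 1` gives integrability at the origin, `1 < s + a` at infinity. -/
lemma lintegral_one_add_rpow_mul_rpow_lt_top {a s : ℝ} (ha1 : a < 1)
    (hs : 1 < s + a) :
    ∫⁻ x : ℝ, (1 + ‖x‖ₑ) ^ (-s) * ‖x‖ₑ ^ (-a) < ∞ := by
  have hs0 : 0 < s := by linarith
  rw [lintegral_eq_two_mul_Ioi_of_even (by simp)]
  refine ENNReal.mul_lt_top (by simp) ?_
  rw [← Set.Ioc_union_Ioi_eq_Ioi (zero_le_one' ℝ)]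
  refine (lintegral_union_le _ _ _).trans_lt (ENNReal.add_lt_top.2 ⟨?_, ?_⟩)
  · have h := (intervalIntegral.intervalIntegrable_rpow' (a := 0) (b := 1)
      (r := -a) (by linarith)).1
    refine (setLIntegral_mono' measurableSet_Ioc fun x hx => ?_).trans_lt h.lintegral_lt_top
    rw [enorm_rpow_eq_ofReal hx.1]
    refine mul_le_of_le_one_left' ?_
    rw [ENNReal.rpow_neg, ENNReal.inv_le_one]
    exact ENNReal.one_le_rpow le_self_add hs0
  · have h := integrableOn_Ioi_rpow_of_lt (a := -s + -a) (c := 1) (by linarith) one_pos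
    refine (setLIntegral_mono' measurableSet_Ioi fun x hx => ?_).trans_lt h.lintegral_lt_top
    have hx0 : (0 : ℝ) < x := one_pos.trans hx
    rw [← enorm_rpow_eq_ofReal hx0, ENNReal.rpow_add _ _ (by simpa using hx0.ne') (by simp)]
    gcongr ?_ * _
    rw [ENNReal.rpow_neg, ENNReal.rpow_neg]
    gcongr
    exact le_add_self

/-- A shifted bump integrated against a power weight, uniformly in the shift. -/
lemma exists_lintegral_shift_rpow_le {a s : ℝ} (ha : 0 ≤ a) (ha1 : a < 1) (hs : 1 < s + a) :
    ∃ K : ℝ≥0∞, K ≠ ∞ ∧ ∀ (M L : ℝ≥0∞) (c : ℝ), M ≠ 0 → M ≠ ∞ → L ≠ 0 → L ≠ ∞ →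
      ∫⁻ u : ℝ, (M + L * ‖u + c‖ₑ) ^ (-s) * ‖u‖ₑ ^ (-a) ≤
        K * L ^ (-(1 - a)) * M ^ (-(s - (1 - a))) := by
  have hs0 : 0 < s := by linarith
  refine ⟨2 * ∫⁻ x : ℝ, (1 + ‖x‖ₑ) ^ (-s) * ‖x‖ₑ ^ (-a), ENNReal.mul_ne_top (by simp)
    (lintegral_one_add_rpow_mul_rpow_lt_top ha1 hs).ne, fun M L c hM hM' hL hL' => ?_⟩
  set h : ℝ → ℝ≥0∞ := fun u => (M + L * ‖u‖ₑ) ^ (-s) * ‖u‖ₑ ^ (-a) with hh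
  have hhm : Measurable h := by fun_prop
  -- Both exponents are nonpositive, so replacing the larger of |u|, |u + c| by the smaller only
  -- increases the integrand. The two resulting terms have the same integral by translation
  -- invariance, whence uniformity in `c`.
  have hpt : ∀ u : ℝ, (M + L * ‖u + c‖ₑ) ^ (-s) * ‖u‖ₑ ^ (-a) ≤ h u + h (u + c) := by
    intro u
    rcases le_total ‖u‖ₑ ‖u + c‖ₑ with H | H
    · refine le_add_right ?_
      simp only [hh, ENNReal.rpow_neg]
      gcongr
    · refine le_add_left ?_
      simp only [hh, ENNReal.rpow_neg]
      gcongr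
  -- Substitute u = (M/L) x.
  have hscale : ∫⁻ u, h u = (∫⁻ x : ℝ, (1 + ‖x‖ₑ) ^ (-s) * ‖x‖ₑ ^ (-a)) *
      L ^ (-(1 - a)) * M ^ (-(s - (1 - a))) := by
    obtain ⟨m, rfl⟩ : ∃ m : ℝ≥0, (m : ℝ≥0∞) = M := ⟨M.toNNReal, ENNReal.coe_toNNReal hM'⟩
    obtain ⟨l, rfl⟩ : ∃ l : ℝ≥0, (l : ℝ≥0∞) = L := ⟨L.toNNReal, ENNReal.coe_toNNReal hL'⟩
    have hm : 0 < m := pos_iff_ne_zero.2 (by simpa using hM)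
    have hl : 0 < l := pos_iff_ne_zero.2 (by simpa using hL)
    have hr : ((m / l : ℝ≥0) : ℝ) ≠ 0 := by positivity
    conv_lhs => rw [← Real.smul_map_volume_mul_left hr]
    rw [lintegral_smul_measure, lintegral_map hhm (measurable_const_mul _)]
    have hx : ∀ x : ℝ, h (((m / l : ℝ≥0) : ℝ) * x) =
        ((m : ℝ≥0∞) ^ (-s) * ((m / l : ℝ≥0) : ℝ≥0∞) ^ (-a)) *
          ((1 + ‖x‖ₑ) ^ (-s) * ‖x‖ₑ ^ (-a)) := by
      intro x
      have e1 : ‖((m / l : ℝ≥0) : ℝ) * x‖ₑ = ((m / l : ℝ≥0) : ℝ≥0∞) * ‖x‖ₑ := by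
        rw [enorm_mul]; congr 1; simp [enorm_eq_nnnorm]
      have e2 : (m : ℝ≥0∞) + l * (((m / l : ℝ≥0) : ℝ≥0∞) * ‖x‖ₑ) = m * (1 + ‖x‖ₑ) := by
        rw [← mul_assoc, ← ENNReal.coe_mul, mul_div_cancel₀ _ hl.ne']
        ring
      simp only [hh]
      rw [e1, e2, ENNReal.mul_rpow_of_ne_top (by simp) (by simp),
        ENNReal.mul_rpow_of_ne_top (by simp) (by simp)]
      ring
    simp_rw [hx]
    rw [lintegral_const_mul _ (by fun_prop), NNReal.abs_eq, ENNReal.ofReal_coe_nnreal,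
      smul_eq_mul, mul_comm _ (∫⁻ _, _), ← mul_assoc, mul_comm _ (∫⁻ _, _), mul_assoc, mul_assoc]
    congr 1
    have h1 : (m : ℝ≥0∞) ^ (-s) = ((m ^ (-s) : ℝ≥0) : ℝ≥0∞) :=
      (ENNReal.coe_rpow_of_ne_zero hm.ne' _).symm
    have h2 : ((m / l : ℝ≥0) : ℝ≥0∞) ^ (-a) = (((m / l) ^ (-a) : ℝ≥0) : ℝ≥0∞) :=
      (ENNReal.coe_rpow_of_ne_zero (by positivity) _).symm
    have h3 : (l : ℝ≥0∞) ^ (-(1 - a)) = ((l ^ (-(1 - a)) : ℝ≥0) : ℝ≥0∞) :=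
      (ENNReal.coe_rpow_of_ne_zero hl.ne' _).symm
    have h4 : (m : ℝ≥0∞) ^ (-(s - (1 - a))) = ((m ^ (-(s - (1 - a))) : ℝ≥0) : ℝ≥0∞) :=
      (ENNReal.coe_rpow_of_ne_zero hm.ne' _).symm
    rw [h1, h2, h3, h4]
    norm_cast
    rw [NNReal.div_rpow, show -(s - (1 - a)) = -s + -a + 1 by ring,
      show -(1 - a) = a - 1 by ring, NNReal.rpow_add hm.ne', NNReal.rpow_add hm.ne',
      NNReal.rpow_sub hl.ne', NNReal.rpow_one, NNReal.rpow_one, NNReal.rpow_neg l]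
    field_simp
  calc ∫⁻ u : ℝ, (M + L * ‖u + c‖ₑ) ^ (-s) * ‖u‖ₑ ^ (-a) ≤ ∫⁻ u, (h u + h (u + c)) :=
        lintegral_mono hpt
    _ = 2 * ∫⁻ u, h u := by
        rw [lintegral_add_left hhm, lintegral_add_right_eq_self, two_mul]
    _ = _ := by rw [hscale]; ring

/-- The affine lift `(1, u_0, …, u_{n-1}, 0, 0, …)` of a vector. -/
def affineLift {n : ℕ} (u : Fin n → ℝ) : ℕ → ℝ
  | 0 => 1
  | k + 1 => if h : k < n then u ⟨k, h⟩ else 0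

lemma affineLift_fin_succ {n : ℕ} (u : Fin n → ℝ) (i : Fin n) :
    affineLift u (i + 1) = u i := by
  simp [affineLift]

lemma affineLift_snoc {n : ℕ} (u : Fin n → ℝ) (x : ℝ) {k : ℕ} (hk : k < n + 1) :
    affineLift (Fin.snoc u x : Fin (n + 1) → ℝ) k = affineLift u k := by
  cases k with
  | zero => rfl
  | succ k =>
    have hk' : k < n := by omega
    have := Fin.snoc_castSucc (α := fun _ => ℝ) x u ⟨k, hk'⟩
    simpa [affineLift, hk', Nat.lt_succ_of_lt hk'] using this

lemma affineLift_snoc_last {n : ℕ} (u : Fin n → ℝ) (x : ℝ) :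
    affineLift (Fin.snoc u x : Fin (n + 1) → ℝ) (n + 1) = x := by
  simp only [affineLift, Nat.lt_add_one, dif_pos]
  exact Fin.snoc_last (α := fun _ => ℝ) x u

lemma measurable_affineLift {n : ℕ} (k : ℕ) :
    Measurable fun u : Fin n → ℝ => affineLift u k := by
  cases k with
  | zero => exact measurable_const
  | succ k =>
    by_cases h : k < n
    · simpa [affineLift, h] using measurable_pi_apply (⟨k, h⟩ : Fin n)
    · simp [affineLift, h]

/-- The weighted size `∑ L_k |v_k + ∑_{j<k} c_{kj} v_j|`, `k ≤ n`, of a unipotent triangular image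
of a vector. -/
noncomputable def triangularSize (n : ℕ) (L : ℕ → ℝ≥0∞) (c : ℕ → ℕ → ℝ) (v : ℕ → ℝ) : ℝ≥0∞ :=
  ∑ k ∈ Finset.range (n + 1), L k * ‖v k + ∑ j ∈ Finset.range k, c k j * v j‖ₑ

lemma triangularSize_ne_zero {n : ℕ} {L : ℕ → ℝ≥0∞} (hL : ∀ k, L k ≠ 0) (c : ℕ → ℕ → ℝ)
    {v : ℕ → ℝ} (hv : v 0 ≠ 0) : triangularSize n L c v ≠ 0 := by
  intro h
  have := (Finset.sum_eq_zero_iff.1 h) 0 (by simp)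
  simp [hL, hv] at this

lemma triangularSize_ne_top {n : ℕ} {L : ℕ → ℝ≥0∞} (hL : ∀ k, L k ≠ ∞) (c : ℕ → ℕ → ℝ)
    (v : ℕ → ℝ) : triangularSize n L c v ≠ ∞ :=
  ENNReal.sum_ne_top.2 fun k _ => ENNReal.mul_ne_top (hL k) enorm_ne_top

lemma triangularSize_congr {n : ℕ} {L : ℕ → ℝ≥0∞} {c : ℕ → ℕ → ℝ} {v w : ℕ → ℝ}
    (h : ∀ k < n + 1, v k = w k) : triangularSize n L c v = triangularSize n L c w := by
  refine Finset.sum_congr rfl fun k hk => ?_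
  have hk' := Finset.mem_range.1 hk
  rw [h k hk', Finset.sum_congr rfl fun j hj => by
    rw [h j ((Finset.mem_range.1 hj).trans hk')]]

lemma measurable_triangularSize {X : Type*} [MeasurableSpace X] (n : ℕ) (L : ℕ → ℝ≥0∞)
    (c : ℕ → ℕ → ℝ) {v : ℕ → X → ℝ} (hv : ∀ k, Measurable (v k)) :
    Measurable fun x => triangularSize n L c fun k => v k x := by
  unfold triangularSize
  fun_prop

/-- By triangularity the last coordinate occurs only in the last term of the size. Integrating it
out by the shifted one-dimensional estimate, with the remaining size as `M`, leaves the same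
integral in one dimension less. -/
lemma exists_lintegral_triangularSize_le {b : ℝ} (hb : 0 < b) (hb1 : b ≤ 1) (n : ℕ) :
    ∃ K : ℝ≥0∞, K ≠ ∞ ∧ ∀ (L : ℕ → ℝ≥0∞) (c : ℕ → ℕ → ℝ), (∀ k, L k ≠ 0) → (∀ k, L k ≠ ∞) →
      ∫⁻ u : Fin n → ℝ, triangularSize n L c (affineLift u) ^ (-((n + 1) * b)) *
        ∏ i, ‖u i‖ₑ ^ (-(1 - b)) ≤ K * ∏ k ∈ Finset.range (n + 1), L k ^ (-b) := by
  have hmeas : ∀ (n : ℕ) (L : ℕ → ℝ≥0∞) (c : ℕ → ℕ → ℝ) (r : ℝ), Measurable fun u : Fin n → ℝ =>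
      triangularSize n L c (affineLift u) ^ r * ∏ i, ‖u i‖ₑ ^ (-(1 - b)) := by
    intro n L c r
    refine ((measurable_triangularSize n L c measurable_affineLift).pow_const _).mul ?_
    exact Finset.measurable_prod _ fun i _ => (measurable_pi_apply i).enorm.pow_const _
  induction n with
  | zero =>
    refine ⟨1, by simp, fun L c _ _ => ?_⟩
    simp [triangularSize, affineLift, volume_pi]
  | succ n ih =>
    obtain ⟨K₁, hK₁, h₁⟩ := ih
    -- With these exponents s - (1 - a) = (n + 1) b, exactly the power needed by the induction
    -- hypothesis.
    obtain ⟨K₂, hK₂, h₂⟩ := exists_lintegral_shift_rpow_le (a := 1 - b) (s := (n + 2) * b)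
      (by linarith) (by linarith) (by nlinarith [mul_nonneg n.cast_nonneg hb.le])
    refine ⟨K₁ * K₂, ENNReal.mul_ne_top hK₁ hK₂, fun L c hL hL' => ?_⟩
    rw [lintegral_finSnoc (hmeas _ _ _ _)]
    have hinner : ∀ u : Fin n → ℝ,
        ∫⁻ x : ℝ, triangularSize (n + 1) L c (affineLift (Fin.snoc u x : Fin (n + 1) → ℝ)) ^
            (-(((n + 1 : ℕ) + 1) * b)) *
          ∏ i, ‖(Fin.snoc u x : Fin (n + 1) → ℝ) i‖ₑ ^ (-(1 - b)) ≤
        (triangularSize n L c (affineLift u) ^ (-((n + 1) * b)) * ∏ i, ‖u i‖ₑ ^ (-(1 - b))) *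
          (K₂ * L (n + 1) ^ (-b)) := by
      intro u
      have hsize : ∀ x : ℝ,
          triangularSize (n + 1) L c (affineLift (Fin.snoc u x : Fin (n + 1) → ℝ)) =
            triangularSize n L c (affineLift u) + L (n + 1) *
              ‖x + ∑ j ∈ Finset.range (n + 1), c (n + 1) j * affineLift u j‖ₑ := by
        intro x
        rw [← triangularSize_congr fun k hk => affineLift_snoc u x hk]
        rw [triangularSize, Finset.sum_range_succ, affineLift_snoc_last]
        rw [Finset.sum_congr rfl (g := fun j => c (n + 1) j * affineLift u j) fun j hj => by
          rw [affineLift_snoc u x (Finset.mem_range.1 hj)]]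
        rfl
      simp only [hsize, Fin.prod_univ_castSucc, Fin.snoc_castSucc, Fin.snoc_last]
      simp_rw [mul_comm (∏ i : Fin n, ‖u i‖ₑ ^ (-(1 - b))), ← mul_assoc]
      rw [lintegral_mul_const _ (by fun_prop)]
      have := h₂ (triangularSize n L c (affineLift u)) (L (n + 1))
        (∑ j ∈ Finset.range (n + 1), c (n + 1) j * affineLift u j)
        (triangularSize_ne_zero hL c (by simp [affineLift])) (triangularSize_ne_top hL' c _)
        (hL _) (hL' _)
      rw [show -(((n + 1 : ℕ) + 1) * b) = -((n + 2) * b) by push_cast; ring]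
      refine (mul_le_mul_left this _).trans_eq ?_
      rw [show -((n + 2) * b - (1 - (1 - b))) = -((n + 1) * b) by ring,
        show -(1 - (1 - b)) = -b by ring]
      ring
    refine (lintegral_mono hinner).trans ?_
    rw [lintegral_mul_const _ (hmeas _ _ _ _), Finset.prod_range_succ]
    calc _ ≤ (K₁ * ∏ k ∈ Finset.range (n + 1), L k ^ (-b)) * (K₂ * L (n + 1) ^ (-b)) := by
          gcongr; exact h₁ L c hL hL'
      _ = _ := by ring

/-! ### The monomial change of variables -/

/-- The map whose coordinates are the monomials `t ^ α_i`. -/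
def monomialMap {n : ℕ} (α : Fin n → Fin n → ℕ) (t : Fin n → ℝ) : Fin n → ℝ :=
  fun i => multiPow t (α i)

/-- The exponent matrix of a family of multiindices. -/
def exponentMatrix {n : ℕ} (α : Fin n → Fin n → ℕ) : Matrix (Fin n) (Fin n) ℝ :=
  Matrix.of fun i j => (α i j : ℝ)

/-- The Jacobian matrix of `monomialMap α` off the coordinate hyperplanes. -/
noncomputable def monomialJacobian {n : ℕ} (α : Fin n → Fin n → ℕ) (t : Fin n → ℝ) :
    Matrix (Fin n) (Fin n) ℝ :=
  Matrix.diagonal (monomialMap α t) * exponentMatrix α * Matrix.diagonal fun j => (t j)⁻¹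

section

variable {n : ℕ} (α : Fin n → Fin n → ℕ)

lemma measurable_monomialMap : Measurable (monomialMap α) :=
  measurable_pi_lambda _ fun i => by
    change Measurable fun t : Fin n → ℝ => ∏ j, t j ^ α i j
    fun_prop

lemma exponentMatrix_det_ne_zero
    (hlin : LinearIndependent ℝ (fun i : Fin n => (fun j : Fin n => (α i j : ℝ)))) :
    (exponentMatrix α).det ≠ 0 := by
  have : IsUnit (exponentMatrix α) := Matrix.linearIndependent_rows_iff_isUnit.1 hlin
  exact ((Matrix.isUnit_iff_isUnit_det _).1 this).ne_zero

lemma hasFDerivAt_monomialMap {t : Fin n → ℝ} (ht : ∀ j, t j ≠ 0) :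
    HasFDerivAt (monomialMap α) (Matrix.toLin' (monomialJacobian α t)).toContinuousLinearMap t := by
  rw [hasFDerivAt_pi']
  intro i
  have h1 : ∀ j ∈ Finset.univ, HasFDerivAt (fun s : Fin n → ℝ => s j ^ α i j)
      ((α i j * t j ^ (α i j - 1)) • (ContinuousLinearMap.proj j : (Fin n → ℝ) →L[ℝ] ℝ)) t := by
    intro j _
    have := (hasFDerivAt_apply (𝕜 := ℝ) j t).pow (α i j)
    simpa using this
  have h2 := HasFDerivAt.finsetProd h1
  refine h2.congr_fderiv ?_
  ext w
  simp only [FunLike.coe_sum, Finset.sum_apply, FunLike.coe_smul,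
    Pi.smul_apply, ContinuousLinearMap.proj_apply, smul_eq_mul, ContinuousLinearMap.comp_apply,
    LinearMap.coe_toContinuousLinearMap', Matrix.toLin'_apply, monomialJacobian, Matrix.mulVec,
    dotProduct, Matrix.mul_diagonal, Matrix.diagonal_mul, exponentMatrix, Matrix.of_apply]
  refine Finset.sum_congr rfl fun j _ => ?_
  rw [monomialMap, multiPow, ← Finset.mul_prod_erase _ _ (Finset.mem_univ j)]
  rcases Nat.eq_zero_or_pos (α i j) with h0 | h0
  · simp [h0]
  · obtain ⟨m, hm⟩ : ∃ m, α i j = m + 1 := ⟨α i j - 1, by omega⟩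
    rw [hm, Nat.add_sub_cancel, pow_succ]
    have := ht j
    field_simp

/-- In logarithmic coordinates the map is the invertible exponent matrix, so it determines every
|t_j|; the signs are prescribed by `ε`. -/
lemma injOn_monomialMap (hα : (exponentMatrix α).det ≠ 0) (ε : Fin n → SignType) :
    Set.InjOn (monomialMap α) {t | ∀ j, t j ≠ 0 ∧ SignType.sign (t j) = ε j} := by
  intro t ht s hs hts
  have hlog : ∀ r : Fin n → ℝ, (∀ j, r j ≠ 0) →
      (exponentMatrix α).mulVec (fun j => Real.log (r j)) =
        fun i => Real.log (monomialMap α r i) := by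
    intro r hr
    ext i
    simp only [monomialMap, multiPow, Matrix.mulVec, dotProduct, exponentMatrix, Matrix.of_apply]
    rw [Real.log_prod fun j _ => pow_ne_zero _ (hr j)]
    simp
  have h1 : (exponentMatrix α).mulVec (fun j => Real.log (t j)) =
      (exponentMatrix α).mulVec (fun j => Real.log (s j)) := by
    rw [hlog t fun j => (ht j).1, hlog s fun j => (hs j).1, hts]
  have h2 := Matrix.mulVec_injective_of_isUnit
    ((Matrix.isUnit_iff_isUnit_det _).2 (isUnit_iff_ne_zero.2 hα)) h1
  ext j
  have h3 : |t j| = |s j| := by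
    have := congrFun h2 j
    rw [← Real.log_abs (t j), ← Real.log_abs (s j)] at this
    exact Real.log_injOn_pos (abs_pos.2 (ht j).1) (abs_pos.2 (hs j).1) this
  rw [← sign_mul_abs (t j), ← sign_mul_abs (s j), (ht j).2, (hs j).2, h3]

variable {α} {σ : ℕ}

/-- With T = |∏ t_j|, the hypothesis `hsum` gives ∏ |u_i| = T^σ. The Jacobian is therefore |det α|
T^{σ-1}, and T^{σ-1} = ∏ |u_i|^{1-1/σ}. -/
lemma abs_det_monomialJacobian (hσ : 0 < σ) (hsum : ∀ j : Fin n, ∑ i : Fin n, α i j = σ)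
    {t : Fin n → ℝ} (ht : ∀ j, t j ≠ 0) :
    ENNReal.ofReal |(monomialJacobian α t).det| * ∏ i, ‖monomialMap α t i‖ₑ ^ (-(1 - (σ : ℝ)⁻¹)) =
      ‖(exponentMatrix α).det‖ₑ := by
  have hσ' : (σ : ℝ) ≠ 0 := by positivity
  have hprod : ∏ i, monomialMap α t i = (∏ j, t j) ^ σ := by
    simp only [monomialMap, multiPow]
    rw [Finset.prod_comm, ← Finset.prod_pow]
    refine Finset.prod_congr rfl fun j _ => ?_
    rw [Finset.prod_pow_eq_pow_sum, hsum]
  set T := ‖∏ j, t j‖ₑ with hT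
  have hT0 : T ≠ 0 := by simpa [hT, Finset.prod_eq_zero_iff] using ht
  have hTt : T ≠ ∞ := enorm_ne_top
  have hprod' : ∏ i, ‖monomialMap α t i‖ₑ = T ^ (σ : ℝ) := by
    rw [hT, ENNReal.rpow_natCast, ← enorm_pow, ← hprod]
    simp only [enorm_eq_nnnorm, nnnorm_prod, ENNReal.ofNNReal_finsetProd]
  have hdet : ‖(monomialJacobian α t).det‖ₑ = T ^ (σ : ℝ) * ‖(exponentMatrix α).det‖ₑ * T⁻¹ := by
    rw [monomialJacobian, Matrix.det_mul, Matrix.det_mul, Matrix.det_diagonal,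
      Matrix.det_diagonal, enorm_mul, enorm_mul, hprod, Finset.prod_inv_distrib, enorm_pow,
      enorm_inv (Finset.prod_ne_zero_iff.2 fun j _ => ht j), ENNReal.rpow_natCast]
  rw [← Real.enorm_eq_ofReal_abs, ENNReal.prod_rpow_of_ne_top fun i _ => enorm_ne_top, hprod', hdet,
    ← ENNReal.rpow_mul, ← ENNReal.rpow_neg_one, mul_right_comm (T ^ _), mul_right_comm (T ^ _ * T ^ _),
    ← ENNReal.rpow_add _ _ hT0 hTt, ← ENNReal.rpow_add _ _ hT0 hTt]
  have : (σ : ℝ) + -1 + σ * -(1 - (σ : ℝ)⁻¹) = 0 := by field_simp; ring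
  rw [this, ENNReal.rpow_zero, one_mul]

/-- Change variables on each open orthant, where the map is injective and its Jacobian is cancelled
by the weight up to a constant; the coordinate hyperplanes are null. -/
lemma exists_lintegral_comp_monomialMap_le (hσ : 0 < σ)
    (hlin : LinearIndependent ℝ (fun i : Fin n => (fun j : Fin n => (α i j : ℝ))))
    (hsum : ∀ j : Fin n, ∑ i : Fin n, α i j = σ) :
    ∃ K : ℝ≥0∞, K ≠ ∞ ∧ ∀ H : (Fin n → ℝ) → ℝ≥0∞, Measurable H →
      ∫⁻ t, H (monomialMap α t) ≤ K * ∫⁻ u, H u * ∏ i, ‖u i‖ₑ ^ (-(1 - (σ : ℝ)⁻¹)) := by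
  have hα := exponentMatrix_det_ne_zero α hlin
  have hα' : ‖(exponentMatrix α).det‖ₑ ≠ 0 := by simpa using hα
  set S : (Fin n → SignType) → Set (Fin n → ℝ) :=
    fun ε => {t | ∀ j, t j ≠ 0 ∧ SignType.sign (t j) = ε j} with hS
  have hSm : ∀ ε, MeasurableSet (S ε) := by
    intro ε
    simp only [hS, Set.ofPred_forall]
    refine MeasurableSet.iInter fun j => ?_
    have h1 : MeasurableSet {x : ℝ | x ≠ 0 ∧ SignType.sign x = ε j} := by
      rcases hε : ε j with _ | _ | _
      · have : {x : ℝ | x ≠ 0 ∧ SignType.sign x = SignType.zero} = ∅ := by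
          ext x; simp
        simp_all
      · have : {x : ℝ | x ≠ 0 ∧ SignType.sign x = SignType.neg} = Set.Iio 0 := by
          ext x
          exact ⟨fun h => sign_eq_neg_one_iff.1 h.2, fun h => ⟨h.ne, sign_eq_neg_one_iff.2 h⟩⟩
        simp_all
      · have : {x : ℝ | x ≠ 0 ∧ SignType.sign x = SignType.pos} = Set.Ioi 0 := by
          ext x
          exact ⟨fun h => sign_eq_one_iff.1 h.2, fun h => ⟨h.ne', sign_eq_one_iff.2 h⟩⟩
        simp_all
    exact (measurable_pi_apply (X := fun _ : Fin n => ℝ) j) h1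
  have hcover : ∀ᵐ t : Fin n → ℝ, t ∈ ⋃ ε, S ε := by
    have h0 : ∀ j : Fin n, ∀ᵐ t : Fin n → ℝ, t j ≠ 0 := by
      intro j
      exact (Measure.quasiMeasurePreserving_eval (fun _ : Fin n => (volume : Measure ℝ)) j).ae
        (Measure.ae_ne volume (0 : ℝ))
    filter_upwards [ae_all_iff.2 h0] with t ht
    exact Set.mem_iUnion.2 ⟨fun j => SignType.sign (t j), fun j => ⟨ht j, rfl⟩⟩
  -- One contribution for each sign pattern; patterns with a zero entry give empty pieces and are
  -- counted harmlessly.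
  refine ⟨Fintype.card (Fin n → SignType) * ‖(exponentMatrix α).det‖ₑ⁻¹,
    ENNReal.mul_ne_top (by simp) (by simpa using hα), fun H hH => ?_⟩
  set J := ∫⁻ u, H u * ∏ i, ‖u i‖ₑ ^ (-(1 - (σ : ℝ)⁻¹)) with hJ
  have hpiece : ∀ ε, ∫⁻ t in S ε, H (monomialMap α t) ≤ ‖(exponentMatrix α).det‖ₑ⁻¹ * J := by
    intro ε
    have h1 : ∫⁻ t in S ε, ‖(exponentMatrix α).det‖ₑ * H (monomialMap α t) ≤ J := by
      calc _ = ∫⁻ t in S ε, ENNReal.ofReal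
              |((Matrix.toLin' (monomialJacobian α t)).toContinuousLinearMap).det| *
              (H (monomialMap α t) *
                ∏ i, ‖monomialMap α t i‖ₑ ^ (-(1 - (σ : ℝ)⁻¹))) := by
            refine setLIntegral_congr_fun (hSm ε) fun t ht => ?_
            have h := abs_det_monomialJacobian hσ hsum fun j => (ht j).1
            have hd : ((Matrix.toLin' (monomialJacobian α t)).toContinuousLinearMap).det =
                (monomialJacobian α t).det := by
              rw [LinearMap.det_toContinuousLinearMap, LinearMap.det_toLin']
            simp only [hd]
            rw [← h]; ring
        _ = ∫⁻ u in monomialMap α '' S ε, H u * ∏ i, ‖u i‖ₑ ^ (-(1 - (σ : ℝ)⁻¹)) := by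
            rw [lintegral_image_eq_lintegral_abs_det_fderiv_mul volume (hSm ε)
              (fun t ht => (hasFDerivAt_monomialMap α fun j => (ht j).1).hasFDerivWithinAt)
              (injOn_monomialMap α hα ε)]
        _ ≤ J := setLIntegral_le_lintegral _ _
    rw [lintegral_const_mul' _ _ enorm_ne_top] at h1
    rw [mul_comm]
    exact (ENNReal.le_div_iff_mul_le (Or.inl hα') (Or.inl enorm_ne_top)).2
      (by rwa [mul_comm] at h1)
  calc ∫⁻ t, H (monomialMap α t) = ∫⁻ t in ⋃ ε, S ε, H (monomialMap α t) := by
        rw [Measure.restrict_eq_self_of_ae_mem hcover]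
    _ ≤ ∑' ε, ∫⁻ t in S ε, H (monomialMap α t) := lintegral_iUnion_le _ _
    _ ≤ ∑' _ : Fin n → SignType, ‖(exponentMatrix α).det‖ₑ⁻¹ * J := ENNReal.tsum_le_tsum hpiece
    _ = _ := by rw [tsum_fintype]; simp [mul_assoc]

end

/-! ### Weighted Hölder and the geometric inequality -/

/-- Hölder for G = (G B^{1/p}) · B^{-1/p} with p = (d+σ)/d and p' = (d+σ)/σ, raised to the power d +
σ; note p'/p = d/σ. -/
lemma lintegral_pow_le_of_weight {X : Type*} [MeasurableSpace X] {μ : Measure X} {d σ : ℕ}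
    (hd : 0 < d) (hσ : 0 < σ) {G B : X → ℝ≥0∞} (hG : Measurable G) (hB : Measurable B)
    (hB0 : ∀ x, B x ≠ 0) (hBt : ∀ x, B x ≠ ∞) :
    (∫⁻ x, G x ∂μ) ^ (d + σ) ≤
      (∫⁻ x, G x ^ (((d : ℝ) + σ) / d) * B x ∂μ) ^ d *
        (∫⁻ x, B x ^ (-((d : ℝ) * (σ : ℝ)⁻¹)) ∂μ) ^ σ := by
  have hd' : (0 : ℝ) < d := by positivity
  have hσ' : (0 : ℝ) < σ := by positivity
  set p : ℝ := ((d : ℝ) + σ) / d with hp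
  set p' : ℝ := ((d : ℝ) + σ) / σ with hp'
  have hp0 : 0 < p := by positivity
  have hp0' : 0 < p' := by positivity
  have hpp : p.HolderConjugate p' := by
    rw [Real.holderConjugate_iff]
    refine ⟨?_, ?_⟩
    · rw [hp, lt_div_iff₀ hd']; linarith
    · rw [hp, hp']; field_simp
  have h := ENNReal.lintegral_mul_le_Lp_mul_Lq μ hpp (f := fun x => G x * B x ^ (1 / p))
    (g := fun x => B x ^ (-(1 / p))) (by fun_prop) (by fun_prop)
  have e1 : ∀ x, ((fun x => G x * B x ^ (1 / p)) * fun x => B x ^ (-(1 / p))) x = G x := by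
    intro x
    simp only [Pi.mul_apply]
    rw [mul_assoc, ← ENNReal.rpow_add _ _ (hB0 x) (hBt x), add_neg_cancel, ENNReal.rpow_zero,
      mul_one]
  have e2 : ∀ x, (G x * B x ^ (1 / p)) ^ p = G x ^ p * B x := by
    intro x
    rw [ENNReal.mul_rpow_of_nonneg _ _ hp0.le, ← ENNReal.rpow_mul, one_div_mul_cancel hp0.ne',
      ENNReal.rpow_one]
  have e3 : ∀ x, (B x ^ (-(1 / p))) ^ p' = B x ^ (-((d : ℝ) * (σ : ℝ)⁻¹)) := by
    intro x
    rw [← ENNReal.rpow_mul]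
    congr 1
    rw [hp, hp']; field_simp
  simp only [e1, e2, e3] at h
  refine (pow_le_pow_left' h (d + σ)).trans_eq ?_
  rw [mul_pow, ← ENNReal.rpow_mul_natCast, ← ENNReal.rpow_mul_natCast]
  have i1 : 1 / p * ((d + σ : ℕ) : ℝ) = d := by rw [hp]; push_cast; field_simp
  have i2 : 1 / p' * ((d + σ : ℕ) : ℝ) = σ := by rw [hp']; push_cast; field_simp
  rw [i1, i2, ENNReal.rpow_natCast, ENNReal.rpow_natCast]

section

variable {n : ℕ} {α : Fin n → Fin n → ℕ} {σ : ℕ}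

lemma measurable_affineLift_monomialMap (k : ℕ) :
    Measurable fun t : Fin n → ℝ => affineLift (monomialMap α t) k :=
  (measurable_affineLift k).comp (measurable_monomialMap α)

/-- The integrals `∫ |A (1, t ^ α_1, …, t ^ α_n)| ^ (-(n + 1) / σ) dt` are bounded uniformly over
unipotent triangular maps followed by diagonal ones of fixed determinant. -/
lemma exists_lintegral_triangularSize_monomialMap_le (hσ : 0 < σ)
    (hlin : LinearIndependent ℝ (fun i : Fin n => (fun j : Fin n => (α i j : ℝ))))
    (hsum : ∀ j : Fin n, ∑ i : Fin n, α i j = σ) :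
    ∃ K : ℝ≥0∞, K ≠ ∞ ∧ ∀ (L : ℕ → ℝ≥0∞) (c : ℕ → ℕ → ℝ), (∀ k, L k ≠ 0) → (∀ k, L k ≠ ∞) →
      (∫⁻ t : Fin n → ℝ, triangularSize n L c (affineLift (monomialMap α t)) ^
        (-(((n + 1 : ℕ) : ℝ) * (σ : ℝ)⁻¹))) ^ σ ≤
          K * ∏ k ∈ Finset.range (n + 1), (L k)⁻¹ := by
  have hb : 0 < (σ : ℝ)⁻¹ := by positivity
  have hb1 : (σ : ℝ)⁻¹ ≤ 1 := inv_le_one_of_one_le₀ (by exact_mod_cast hσ)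
  obtain ⟨K₁, hK₁, h₁⟩ := exists_lintegral_comp_monomialMap_le hσ hlin hsum
  obtain ⟨K₂, hK₂, h₂⟩ := exists_lintegral_triangularSize_le hb hb1 n
  refine ⟨(K₁ * K₂) ^ σ, ENNReal.pow_ne_top (ENNReal.mul_ne_top hK₁ hK₂), fun L c hL hL' => ?_⟩
  have h3 := h₁ (fun u => triangularSize n L c (affineLift u) ^ (-(((n + 1 : ℕ) : ℝ) * (σ : ℝ)⁻¹)))
    ((measurable_triangularSize n L c measurable_affineLift).pow_const _)
  have h4 := h₂ L c hL hL'
  push_cast at h3 ⊢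
  refine (pow_le_pow_left' (h3.trans (mul_le_mul_right h4 K₁)) σ).trans_eq ?_
  rw [← mul_assoc, mul_pow, ← Finset.prod_pow]
  congr 1
  refine Finset.prod_congr rfl fun k _ => ?_
  rw [← ENNReal.rpow_natCast, ← ENNReal.rpow_mul, ← ENNReal.rpow_neg_one]
  congr 1
  field_simp

/-- The geometric inequality for densities with finite first moments. -/
lemma exists_lintegral_pow_le_lintegral_det_of_moments (hσ : 0 < σ)
    (hlin : LinearIndependent ℝ (fun i : Fin n => (fun j : Fin n => (α i j : ℝ))))
    (hsum : ∀ j : Fin n, ∑ i : Fin n, α i j = σ) :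
    ∃ K : ℝ≥0∞, K ≠ ∞ ∧ ∀ G : (Fin n → ℝ) → ℝ≥0∞, Measurable G →
      (∀ k, ∫⁻ t, G t ^ ((((n + 1 : ℕ) : ℝ) + σ) / (n + 1 : ℕ)) *
        ‖affineLift (monomialMap α t) k‖ₑ ≠ ∞) →
      (∫⁻ t, G t) ^ (n + 1 + σ) ≤ K * ∫⁻ τ : Fin (n + 1) → Fin n → ℝ,
        (∏ i, G (τ i) ^ ((((n + 1 : ℕ) : ℝ) + σ) / (n + 1 : ℕ))) *
          ‖(Matrix.of fun i j : Fin (n + 1) => affineLift (monomialMap α (τ i)) j).det‖ₑ := by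
  obtain ⟨K, hK, hKle⟩ := exists_lintegral_triangularSize_monomialMap_le hσ hlin hsum
  refine ⟨(n + 1 : ℕ) ^ (n + 1) * K, ENNReal.mul_ne_top (by simp) hK, fun G hG hmom => ?_⟩
  set W : (Fin n → ℝ) → ℝ≥0∞ := fun t => G t ^ ((((n + 1 : ℕ) : ℝ) + σ) / (n + 1 : ℕ)) with hW
  have hWm : Measurable W := hG.pow_const _
  set v : ℕ → (Fin n → ℝ) → ℝ := fun k t => affineLift (monomialMap α t) k with hv
  have hvm : ∀ k, Measurable (v k) := measurable_affineLift_monomialMap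
  set h : ℕ → (ℕ → ℝ) → ℝ≥0∞ := fun k c =>
    ∫⁻ t, W t * ‖v k t + ∑ j ∈ Finset.range k, c j * v j t‖ₑ with hh
  set D : ℕ → ℝ≥0∞ := fun k => ⨅ c, h k c with hD
  have hDt : ∀ k, D k ≠ ∞ := fun k => ne_top_of_le_ne_top (hmom k) <|
    (iInf_le _ (fun _ => 0)).trans_eq (by simp [hh, hv, hW])
  have hdet := prod_le_lintegral_det v hvm W hWm D (fun k c => iInf_le _ c) (n + 1)
  refine le_trans ?_ (mul_le_mul_right hdet _)
  -- The slack `ε` covers infima that are not attained and keeps `L k` finite when `D k = 0`.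
  have hε : ∀ ε : ℝ≥0∞, ε ≠ 0 → ε ≠ ∞ → (∫⁻ t, G t) ^ (n + 1 + σ) ≤
      (n + 1 : ℕ) ^ (n + 1) * K * ∏ k ∈ Finset.range (n + 1), (D k + ε) := by
    intro ε hε0 hεt
    have hex : ∀ k, ∃ c, h k c < D k + ε := fun k =>
      iInf_lt_iff.1 (ENNReal.lt_add_right (hDt k) hε0)
    choose c hc using hex
    set L : ℕ → ℝ≥0∞ := fun k => (D k + ε)⁻¹ with hL
    have hDε0 : ∀ k, D k + ε ≠ 0 := fun k => by simp [hε0]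
    have hDεt : ∀ k, D k + ε ≠ ∞ := fun k => ENNReal.add_ne_top.2 ⟨hDt k, hεt⟩
    have hL0 : ∀ k, L k ≠ 0 := fun k => ENNReal.inv_ne_zero.2 (hDεt k)
    have hLt : ∀ k, L k ≠ ∞ := fun k => ENNReal.inv_ne_top.2 (hDε0 k)
    have h1 := lintegral_pow_le_of_weight (μ := volume) n.succ_pos hσ hG
      (measurable_triangularSize n L c hvm)
      (fun t => triangularSize_ne_zero hL0 c (by simp [hv, affineLift]))
      (fun t => triangularSize_ne_top hLt c _)
    have h2 : ∫⁻ t, W t * triangularSize n L c (fun k => v k t) ≤ (n + 1 : ℕ) := by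
      simp only [triangularSize, Finset.mul_sum]
      rw [lintegral_finsetSum _ fun k _ => by fun_prop]
      calc _ ≤ ∑ k ∈ Finset.range (n + 1), (1 : ℝ≥0∞) := by
            refine Finset.sum_le_sum fun k _ => ?_
            rw [lintegral_congr fun t => mul_left_comm (W t) (L k) _,
              lintegral_const_mul' _ _ (hLt k)]
            calc _ ≤ L k * (D k + ε) := by gcongr; exact (hc k).le
              _ = 1 := ENNReal.inv_mul_cancel (hDε0 k) (hDεt k)
        _ = _ := by simp
    refine h1.trans ?_
    rw [mul_assoc]
    refine mul_le_mul' (pow_le_pow_left' h2 _) ((hKle L c hL0 hLt).trans_eq ?_)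
    simp [hL]
  -- Let ε = 1/(m+1) tend to 0. Finiteness of every `D k`, hence the moment hypothesis, makes the
  -- product converge.
  have hlim : Filter.Tendsto (fun m : ℕ => (n + 1 : ℕ) ^ (n + 1) * K *
      ∏ k ∈ Finset.range (n + 1), (D k + ((m : ℝ≥0∞) + 1)⁻¹)) Filter.atTop
      (nhds ((n + 1 : ℕ) ^ (n + 1) * K * ∏ k ∈ Finset.range (n + 1), (D k + 0))) := by
    refine ENNReal.Tendsto.const_mul ?_ (Or.inr (ENNReal.mul_ne_top (by simp) hK))
    refine ENNReal.tendsto_finsetProd_of_ne_top _ (fun k _ => ?_) (fun k _ => by simpa using hDt k)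
    refine tendsto_const_nhds.add ?_
    have := (Filter.tendsto_add_atTop_iff_nat 1).2 ENNReal.tendsto_inv_nat_nhds_zero
    simpa using this
  simp only [add_zero] at hlim
  exact ge_of_tendsto' hlim fun m => hε _ (by simp) (by simp)

end

section

variable {n : ℕ} {α : Fin n → Fin n → ℕ} {σ : ℕ}

lemma enorm_affineLift_le {u : Fin n → ℝ} {N : ℕ} (hu : ‖u‖ ≤ N) (k : ℕ) :
    ‖affineLift u k‖ₑ ≤ (N + 1 : ℕ) := by
  have h : ‖affineLift u k‖ ≤ (N + 1 : ℕ) := by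
    push_cast
    have hN : (0 : ℝ) ≤ N := N.cast_nonneg
    rcases k with _ | k
    · simp [affineLift]
    · by_cases hk : k < n
      · simp only [affineLift, hk, dif_pos]
        linarith [norm_le_pi_norm u ⟨k, hk⟩]
      · simpa [affineLift, hk] using by linarith
  rw [← ofReal_norm]
  exact (ENNReal.ofReal_le_ofReal h).trans_eq (ENNReal.ofReal_natCast _)

/-- The geometric inequality: the mass of a density is controlled by the average absolute
determinant of `n + 1` points of the moment-type surface `(1, t ^ α_1, …, t ^ α_n)`. -/
lemma exists_lintegral_pow_le_lintegral_det (hσ : 0 < σ)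
    (hlin : LinearIndependent ℝ (fun i : Fin n => (fun j : Fin n => (α i j : ℝ))))
    (hsum : ∀ j : Fin n, ∑ i : Fin n, α i j = σ) :
    ∃ K : ℝ≥0∞, K ≠ ∞ ∧ ∀ G : (Fin n → ℝ) → ℝ≥0∞, Measurable G →
      (∫⁻ t, G t) ^ (n + 1 + σ) ≤ K * ∫⁻ τ : Fin (n + 1) → Fin n → ℝ,
        (∏ i, G (τ i) ^ ((((n + 1 : ℕ) : ℝ) + σ) / (n + 1 : ℕ))) *
          ‖(Matrix.of fun i j : Fin (n + 1) => affineLift (monomialMap α (τ i)) j).det‖ₑ := by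
  obtain ⟨K, hK, hKle⟩ := exists_lintegral_pow_le_lintegral_det_of_moments hσ hlin hsum
  refine ⟨K, hK, fun G hG => ?_⟩
  set p : ℝ := (((n + 1 : ℕ) : ℝ) + σ) / (n + 1 : ℕ) with hp
  have hp0 : 0 < p := by positivity
  set S : ℕ → Set (Fin n → ℝ) := fun N => {t | ‖t‖ ≤ N ∧ ‖monomialMap α t‖ ≤ N} with hS
  have hSm : ∀ N, MeasurableSet (S N) := fun N =>
    (measurableSet_le measurable_norm measurable_const).inter
      (measurableSet_le (measurable_monomialMap α).norm measurable_const)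
  -- Truncations that are bounded, with bounded support and bounded monomials there, have finite
  -- moments. They increase to `G`, so monotone convergence handles the left side, while the right
  -- side is monotone in the density.
  set g : ℕ → (Fin n → ℝ) → ℝ≥0∞ := fun N => (S N).indicator fun t => min (G t) N with hg
  have hgm : ∀ N, Measurable (g N) := fun N => (hG.min measurable_const).indicator (hSm N)
  have hgle : ∀ N t, g N t ≤ G t := fun N t =>
    (Set.indicator_le_self _ _ t).trans (min_le_left _ _)
  have hmono : Monotone g := by
    intro N M hNM t
    have hNM' : (N : ℝ) ≤ M := by exact_mod_cast hNM
    by_cases ht : t ∈ S N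
    · have ht' : t ∈ S M := ⟨ht.1.trans hNM', ht.2.trans hNM'⟩
      simp only [hg, Set.indicator_of_mem ht, Set.indicator_of_mem ht']
      exact min_le_min_left _ (by exact_mod_cast hNM)
    · simp [hg, Set.indicator_of_notMem ht]
  have hlim : ∀ t, Filter.Tendsto (fun N => g N t) Filter.atTop (nhds (G t)) := by
    intro t
    have h1 : Filter.Tendsto (fun N : ℕ => min (G t) N) Filter.atTop (nhds (min (G t) ∞)) :=
      tendsto_const_nhds.min ENNReal.tendsto_nat_nhds_top
    rw [min_eq_left le_top] at h1
    refine h1.congr' ?_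
    obtain ⟨N₁, h₁⟩ := exists_nat_ge ‖t‖
    obtain ⟨N₂, h₂⟩ := exists_nat_ge ‖monomialMap α t‖
    filter_upwards [Filter.eventually_ge_atTop N₁, Filter.eventually_ge_atTop N₂] with N hN₁ hN₂
    have ht : t ∈ S N := ⟨h₁.trans (by exact_mod_cast hN₁), h₂.trans (by exact_mod_cast hN₂)⟩
    simp [hg, Set.indicator_of_mem ht]
  have hint := lintegral_tendsto_of_tendsto_of_monotone (μ := volume)
    (fun N => (hgm N).aemeasurable) (Filter.Eventually.of_forall fun t N M h => hmono h t)
    (Filter.Eventually.of_forall hlim)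
  refine le_of_tendsto' (ENNReal.Tendsto.pow (n := n + 1 + σ) hint) fun N => ?_
  refine (hKle (g N) (hgm N) fun k => ?_).trans ?_
  · have hbound : ∀ t, g N t ^ p * ‖affineLift (monomialMap α t) k‖ₑ ≤
        (Metric.closedBall (0 : Fin n → ℝ) N).indicator
          (fun _ => (N : ℝ≥0∞) ^ p * (N + 1 : ℕ)) t := by
      intro t
      by_cases ht : t ∈ S N
      · rw [Set.indicator_of_mem (by simpa using ht.1)]
        refine mul_le_mul' (ENNReal.rpow_le_rpow ?_ hp0.le) (enorm_affineLift_le ht.2 k)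
        simp [hg, Set.indicator_of_mem ht]
      · simp [hg, Set.indicator_of_notMem ht, ENNReal.zero_rpow_of_pos hp0]
    refine ne_top_of_le_ne_top ?_ (lintegral_mono hbound)
    rw [lintegral_indicator_const measurableSet_closedBall]
    exact ENNReal.mul_ne_top (ENNReal.mul_ne_top
      (ENNReal.rpow_ne_top_of_nonneg hp0.le (by simp)) (by simp)) measure_closedBall_lt_top.ne
  · gcongr with τ i
    exact hgle N _

/-! ### From the geometric inequality to the averaging estimate -/

/-- Substitute s = A y and apply Tonelli. Only an inequality is claimed, since for singular A the
left side vanishes. -/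
lemma lintegral_prod_mulVec_mul_det_le {d : ℕ} (A : Matrix (Fin d) (Fin d) ℝ)
    {g : Fin d → ℝ → ℝ≥0∞} (hg : ∀ i, Measurable (g i)) :
    ∫⁻ y : Fin d → ℝ, (∏ i, g i (A.mulVec y i)) * ‖A.det‖ₑ ≤ ∏ i, ∫⁻ s, g i s := by
  by_cases h0 : A.det = 0
  · simp [h0]
  have hm : Measurable fun s : Fin d → ℝ => ∏ i, g i (s i) :=
    Finset.measurable_prod _ fun i _ => (hg i).comp (measurable_pi_apply i)
  have hA : Measurable (Matrix.toLin' A) :=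
    (LinearMap.continuous_of_finiteDimensional _).measurable
  have h1 : ∫⁻ y : Fin d → ℝ, ∏ i, g i (A.mulVec y i) =
      ‖A.det‖ₑ⁻¹ * ∫⁻ s : Fin d → ℝ, ∏ i, g i (s i) := by
    have := lintegral_map hm hA (μ := volume)
    rw [Real.map_matrix_volume_pi_eq_smul_volume_pi h0, lintegral_smul_measure,
      ← Real.enorm_eq_ofReal_abs, enorm_inv h0] at this
    simpa using this.symm
  rw [lintegral_mul_const' _ _ enorm_ne_top, h1, lintegral_finProd hg, mul_right_comm,
    ENNReal.inv_mul_cancel (by simpa using h0) enorm_ne_top, one_mul]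

lemma measurable_graphPoint :
    Measurable fun q : (Fin (n + 1) → ℝ) × (Fin n → ℝ) => graphPoint α q.1 q.2 := by
  unfold graphPoint multiPow
  fun_prop

lemma graphPoint_eq (y : Fin (n + 1) → ℝ) (t : Fin n → ℝ) :
    graphPoint α y t =
      (t, ∑ j : Fin (n + 1), affineLift (monomialMap α t) j * y j) := by
  simp only [graphPoint, Fin.sum_univ_succ, Fin.val_succ, affineLift_fin_succ, monomialMap]
  simp [affineLift, mul_comm]

/-- The estimate for nonnegative functions. -/
lemma exists_lintegral_averaging_pow_le (hσ : 0 < σ)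
    (hlin : LinearIndependent ℝ (fun i : Fin n => (fun j : Fin n => (α i j : ℝ))))
    (hsum : ∀ j : Fin n, ∑ i : Fin n, α i j = σ) :
    ∃ K : ℝ≥0∞, K ≠ ∞ ∧ ∀ F : (Fin n → ℝ) × ℝ → ℝ≥0∞, Measurable F →
      ∫⁻ y, (∫⁻ t, F (graphPoint α y t)) ^ (n + 1 + σ) ≤
        K * (∫⁻ z, F z ^ ((((n + 1 : ℕ) : ℝ) + σ) / (n + 1 : ℕ))) ^ (n + 1) := by
  obtain ⟨K, hK, hKle⟩ := exists_lintegral_pow_le_lintegral_det hσ hlin hsum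
  refine ⟨K, hK, fun F hF => ?_⟩
  set p : ℝ := (((n + 1 : ℕ) : ℝ) + σ) / (n + 1 : ℕ) with hp
  have hdet : Measurable fun τ : Fin (n + 1) → Fin n → ℝ =>
      (Matrix.of fun i j : Fin (n + 1) => affineLift (monomialMap α (τ i)) j).det := by
    simp only [Matrix.det_apply, Matrix.of_apply]
    refine Finset.measurable_sum _ fun ρ _ => Measurable.const_smul ?_ _
    exact Finset.measurable_prod _ fun i _ =>
      (measurable_affineLift_monomialMap _).comp (measurable_pi_apply _)
  have hjoint : Measurable fun q : (Fin (n + 1) → ℝ) × (Fin (n + 1) → Fin n → ℝ) =>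
      (∏ i, F (graphPoint α q.1 (q.2 i)) ^ p) *
        ‖(Matrix.of fun i j : Fin (n + 1) => affineLift (monomialMap α (q.2 i)) j).det‖ₑ := by
    refine Measurable.mul (Finset.measurable_prod _ fun i _ => ?_)
      (hdet.comp measurable_snd).enorm
    exact (hF.comp (measurable_graphPoint.comp (measurable_fst.prodMk
      ((measurable_pi_apply i).comp measurable_snd)))).pow_const _
  calc ∫⁻ y, (∫⁻ t, F (graphPoint α y t)) ^ (n + 1 + σ)
      ≤ ∫⁻ y, K * ∫⁻ τ : Fin (n + 1) → Fin n → ℝ, (∏ i, F (graphPoint α y (τ i)) ^ p) *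
          ‖(Matrix.of fun i j : Fin (n + 1) => affineLift (monomialMap α (τ i)) j).det‖ₑ :=
        lintegral_mono fun y => hKle _
          (hF.comp (measurable_graphPoint.comp (measurable_const.prodMk measurable_id)))
    _ = K * ∫⁻ τ : Fin (n + 1) → Fin n → ℝ, ∫⁻ y, (∏ i, F (graphPoint α y (τ i)) ^ p) *
          ‖(Matrix.of fun i j : Fin (n + 1) => affineLift (monomialMap α (τ i)) j).det‖ₑ := by
        rw [lintegral_const_mul' _ _ hK, lintegral_lintegral_swap hjoint.aemeasurable]
    -- For fixed τ the heights of the n + 1 graph points are A y, where A has rows v(τ_i).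
    _ ≤ K * ∫⁻ τ : Fin (n + 1) → Fin n → ℝ, ∏ i, ∫⁻ s, F (τ i, s) ^ p := by
        gcongr with τ
        simp only [graphPoint_eq]
        exact lintegral_prod_mulVec_mul_det_le
          (Matrix.of fun i j : Fin (n + 1) => affineLift (monomialMap α (τ i)) j)
          (g := fun i s => F (τ i, s) ^ p) fun i => by fun_prop
    _ = K * (∫⁻ z, F z ^ p) ^ (n + 1) := by
        rw [lintegral_finProd (g := fun _ t => ∫⁻ s, F (t, s) ^ p)
          fun _ => (hF.pow_const p).lintegral_prod_right']
        rw [Measure.volume_eq_prod, lintegral_prod _ (hF.pow_const p).aemeasurable]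
        simp

end

/-! ### Almost everywhere statements and the final bound -/

section

variable {n : ℕ} {α : Fin n → Fin n → ℕ} {σ : ℕ}

/-- The estimate for nonnegative functions, applied to the indicator of a measurable null set, shows
that almost every graph meets that set in a null set of t. This allows f to be replaced by a
measurable representative. -/
lemma ae_ae_graphPoint_of_ae (hσ : 0 < σ)
    (hlin : LinearIndependent ℝ (fun i : Fin n => (fun j : Fin n => (α i j : ℝ))))
    (hsum : ∀ j : Fin n, ∑ i : Fin n, α i j = σ) {P : (Fin n → ℝ) × ℝ → Prop}
    (hP : ∀ᵐ z, P z) : ∀ᵐ y : Fin (n + 1) → ℝ, ∀ᵐ t : Fin n → ℝ, P (graphPoint α y t) := by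
  obtain ⟨K, -, hKle⟩ := exists_lintegral_averaging_pow_le hσ hlin hsum
  obtain ⟨N, hPN, hNm, hN0⟩ := exists_measurable_superset_of_null (ae_iff.1 hP)
  have hF : Measurable (N.indicator fun _ => (1 : ℝ≥0∞)) := measurable_const.indicator hNm
  have hp : 0 < (((n + 1 : ℕ) : ℝ) + σ) / (n + 1 : ℕ) := by positivity
  have hgm : Measurable fun q : (Fin (n + 1) → ℝ) × (Fin n → ℝ) =>
      N.indicator (fun _ => (1 : ℝ≥0∞)) (graphPoint α q.1 q.2) := hF.comp measurable_graphPoint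
  have h0 : ∫⁻ z, (N.indicator (fun _ => (1 : ℝ≥0∞)) z) ^
      ((((n + 1 : ℕ) : ℝ) + σ) / (n + 1 : ℕ)) = 0 := by
    rw [lintegral_eq_zero_iff (hF.pow_const _)]
    filter_upwards [measure_eq_zero_iff_ae_notMem.1 hN0] with z hz
    simp only [Set.indicator_of_notMem hz, Pi.zero_apply]
    exact ENNReal.zero_rpow_of_pos hp
  have h1 := hKle _ hF
  rw [h0, zero_pow n.succ_ne_zero, mul_zero, nonpos_iff_eq_zero,
    lintegral_eq_zero_iff (hgm.lintegral_prod_right'.pow_const _)] at h1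
  filter_upwards [h1] with y hy
  have hy' := eq_zero_of_pow_eq_zero hy
  have hgy : Measurable fun t : Fin n → ℝ =>
      N.indicator (fun _ => (1 : ℝ≥0∞)) (graphPoint α y t) :=
    hgm.comp (measurable_const.prodMk measurable_id)
  rw [lintegral_eq_zero_iff hgy] at hy'
  filter_upwards [hy'] with t ht
  by_contra hPt
  have : graphPoint α y t ∈ N := hPN hPt
  simp [Set.indicator_of_mem this] at ht

end

theorem mainTheorem5 {𝕜 : Type*} [RCLike 𝕜] (n : ℕ) (hn : 0 < n)
    (α : Fin n → Fin n → ℕ) (σ : ℕ)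
    (hlin : LinearIndependent ℝ (fun i : Fin n => (fun j : Fin n => (α i j : ℝ))))
    (hsum : ∀ j : Fin n, ∑ i : Fin n, α i j = σ) :
    ∃ C : ℝ≥0, ∀ f : (Fin n → ℝ) × ℝ → 𝕜,
      MemLp f (((n : ℝ≥0∞) + 1 + (σ : ℝ≥0∞)) / ((n : ℝ≥0∞) + 1)) volume →
        (∀ᵐ y : Fin (n + 1) → ℝ, Integrable (fun t : Fin n → ℝ => f (graphPoint α y t)) volume) ∧
        MemLp (averagingOp α f) ((n : ℝ≥0∞) + 1 + (σ : ℝ≥0∞)) volume ∧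
        eLpNorm (averagingOp α f) ((n : ℝ≥0∞) + 1 + (σ : ℝ≥0∞)) volume ≤
          (C : ℝ≥0∞) *
            eLpNorm f (((n : ℝ≥0∞) + 1 + (σ : ℝ≥0∞)) / ((n : ℝ≥0∞) + 1)) volume := by
  have hσ : 0 < σ := by
    rcases Nat.eq_zero_or_pos σ with h | h
    · exfalso
      refine hlin.ne_zero ⟨0, hn⟩ (funext fun j => ?_)
      have := Finset.sum_eq_zero_iff.1 ((hsum j).trans h) ⟨0, hn⟩ (Finset.mem_univ _)
      simpa using this
    · exact h
  obtain ⟨K, hK, hKle⟩ := exists_lintegral_averaging_pow_le hσ hlin hsum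
  set p : ℝ≥0∞ := ((n : ℝ≥0∞) + 1 + (σ : ℝ≥0∞)) / ((n : ℝ≥0∞) + 1) with hp
  set q : ℝ≥0∞ := (n : ℝ≥0∞) + 1 + (σ : ℝ≥0∞) with hq
  have hqr : q.toReal = ((n + 1 + σ : ℕ) : ℝ) := by
    rw [← ENNReal.toReal_natCast]; push_cast; rfl
  have hd : ((n : ℝ≥0∞) + 1).toReal = ((n + 1 : ℕ) : ℝ) := by
    rw [← ENNReal.toReal_natCast]; push_cast; rfl
  have hpr : p.toReal = (((n + 1 : ℕ) : ℝ) + σ) / (n + 1 : ℕ) := by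
    rw [hp, ENNReal.toReal_div, hqr, hd]; push_cast; rfl
  have hq0 : q ≠ 0 := by simp [hq]
  have hqt : q ≠ ∞ := by simp [hq]
  have hp0 : p ≠ 0 := ENNReal.div_ne_zero.2 ⟨hq0, by simp⟩
  have hpt : p ≠ ∞ := ENNReal.div_ne_top hqt (by simp)
  have hqpos : (0 : ℝ) < ((n + 1 + σ : ℕ) : ℝ) := by positivity
  -- The nonnegative estimate bounds the (n+1+σ)-th power of the norm, so the constant is the
  -- corresponding root of `K`.
  set C : ℝ≥0∞ := K ^ (1 / ((n + 1 + σ : ℕ) : ℝ)) with hC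
  have hCt : C ≠ ∞ := ENNReal.rpow_ne_top_of_nonneg (by positivity) hK
  refine ⟨C.toNNReal, fun f hf => ?_⟩
  rw [ENNReal.coe_toNNReal hCt]
  obtain ⟨f', hf'm, hff'⟩ := hf.1
  have hF : Measurable fun z => ‖f' z‖ₑ := hf'm.measurable.enorm
  have hcomp : StronglyMeasurable fun r : (Fin (n + 1) → ℝ) × (Fin n → ℝ) =>
      f' (graphPoint α r.1 r.2) := hf'm.comp_measurable measurable_graphPoint
  have hae := ae_ae_graphPoint_of_ae hσ hlin hsum hff'
  have hmain := hKle _ hF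
  have hnorm : eLpNorm f p volume = (∫⁻ z, ‖f' z‖ₑ ^ p.toReal) ^ (1 / p.toReal) := by
    rw [eLpNorm_congr_ae hff', eLpNorm_eq_lintegral_rpow_enorm_toReal hp0 hpt]
  have hI : ∫⁻ z, ‖f' z‖ₑ ^ p.toReal ≠ ∞ := by
    intro h
    rw [h, ENNReal.top_rpow_of_pos (one_div_pos.2 (ENNReal.toReal_pos hp0 hpt))] at hnorm
    exact hf.2.ne hnorm
  have hfin : ∀ᵐ y : Fin (n + 1) → ℝ, ∫⁻ t, ‖f' (graphPoint α y t)‖ₑ ≠ ∞ := by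
    have hlt := hmain.trans_lt (ENNReal.mul_lt_top hK.lt_top
      (ENNReal.pow_lt_top (by rw [← hpr]; exact hI.lt_top)))
    have hm : Measurable fun y : Fin (n + 1) → ℝ => ∫⁻ t, ‖f' (graphPoint α y t)‖ₑ :=
      hcomp.measurable.enorm.lintegral_prod_right'
    filter_upwards [ae_lt_top (hm.pow_const _) hlt.ne] with y hy hy'
    rw [hy', ENNReal.top_pow (by omega)] at hy
    exact lt_irrefl _ hy
  have havg : averagingOp α f =ᵐ[volume] averagingOp α f' := by
    filter_upwards [hae] with y hy
    exact integral_congr_ae hy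
  have hbound : eLpNorm (averagingOp α f) q volume ≤ C * eLpNorm f p volume := by
    rw [eLpNorm_congr_ae havg, eLpNorm_eq_lintegral_rpow_enorm_toReal hq0 hqt, hnorm, hqr]
    calc (∫⁻ y, ‖averagingOp α f' y‖ₑ ^ ((n + 1 + σ : ℕ) : ℝ)) ^ (1 / ((n + 1 + σ : ℕ) : ℝ))
        ≤ (∫⁻ y, (∫⁻ t, ‖f' (graphPoint α y t)‖ₑ) ^ (n + 1 + σ)) ^
            (1 / ((n + 1 + σ : ℕ) : ℝ)) := by
          simp only [ENNReal.rpow_natCast]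
          gcongr with y
          exact enorm_integral_le_lintegral_enorm _
      _ ≤ (K * (∫⁻ z, ‖f' z‖ₑ ^ p.toReal) ^ (n + 1)) ^ (1 / ((n + 1 + σ : ℕ) : ℝ)) := by
          rw [hpr]; gcongr
      _ = C * (∫⁻ z, ‖f' z‖ₑ ^ p.toReal) ^ (1 / p.toReal) := by
          rw [ENNReal.mul_rpow_of_nonneg _ _ (by positivity), ← ENNReal.rpow_natCast,
            ← ENNReal.rpow_mul, hpr]
          congr 2
          push_cast
          field_simp
  refine ⟨?_, ⟨?_, hbound.trans_lt (ENNReal.mul_lt_top hCt.lt_top hf.2)⟩, hbound⟩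
  · filter_upwards [hae, hfin] with y hy hy'
    refine Integrable.congr ⟨?_, hy'.lt_top⟩ (Filter.EventuallyEq.symm hy)
    exact (hcomp.comp_measurable (measurable_const.prodMk measurable_id)).aestronglyMeasurable
  · exact (hcomp.integral_prod_right').aestronglyMeasurable.congr havg.symm
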